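/- Let $X$ be a compact Hausdorff space that is homogeneous, i.e. for all $x,y\in X$ there is a homeomorphism $h:X\to X$ with $h(x)=y$. Then there exist a minimal topological group $M$ and a continuous action $M\times X\to X$ (jointly continuous) which is transitive, i.e. for all $x,y\in X$ there is $m\in M$ with $mx=y$. Here a topological group is called minimal if it is Hausdorff and its underlying group admits no strictly coarser Hausdorff group topology. -/

import Mathlib

universe u

/-- A topological space is homogeneous if its homeomorphisms act transitively on its points. -/
def IsHomogeneousSpace (X : Type*) [TopologicalSpace X] : Prop :=
  ∀ x y : X, ∃ h : X ≃ₜ X, h x = y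

/-- A group `G` with a topology is a minimal topological group if it is a Hausdorff topological
group and no strictly coarser topology makes it a Hausdorff topological group.
(In Mathlib's order on topologies, `t ≤ s` means that `s` is coarser than `t`.) -/
structure IsMinimalTopologicalGroup (G : Type*) [Group G] [t : TopologicalSpace G] : Prop where
  isTopologicalGroup : IsTopologicalGroup G
  t2Space : T2Space G
  eq_of_coarser : ∀ s : TopologicalSpace G,
    t ≤ s → @IsTopologicalGroup G s _ → @T2Space G s → s = t

open Topology Filter

/-! Let the discrete homeomorphism group `Q` act on `X`; to gain minimality, enlarge it to `ℤˣ ≀ᵣ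
Q`, whose compact base group `N` acts trivially. A coarser Hausdorff group topology agrees with the
original on `N`, and `N` stays open because commutators with `N` detect membership in `N`. -/

theorem IsCompact.of_coarser {Y : Type*} {t s : TopologicalSpace Y} {K : Set Y}
    (hK : @IsCompact Y t K) (h : t ≤ s) : @IsCompact Y s K := by
  simpa using @IsCompact.image Y Y t s K id hK (continuous_id_of_le h)

/-- A Hausdorff topological group is minimal as soon as it has a compact normal subgroup `N`
and a neighbourhood `U` of `1` such that only elements of `N` have all their commutators with `N`
inside `U`. -/
theorem IsMinimalTopologicalGroup.of_isCompact {G : Type*} [Group G]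
    [t : TopologicalSpace G] [IsTopologicalGroup G] [T2Space G] (N : Subgroup G) [N.Normal]
    (hNc : IsCompact (N : Set G)) {U : Set G} (hU : U ∈ 𝓝 (1 : G))
    (hNU : ∀ g : G, (∀ x ∈ N, g * x * g⁻¹ * x⁻¹ ∈ U) → g ∈ N) :
    IsMinimalTopologicalGroup G := by
  have hdiff (O : Set G) : IsCompact ((N : Set G) \ interior O) := hNc.diff isOpen_interior
  have hint (O : Set G) (hO : O ∈ 𝓝 (1 : G)) : 1 ∉ (N : Set G) \ interior O :=
    fun h ↦ h.2 (mem_interior_iff_mem_nhds.2 hO)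
  have hsub (O : Set G) (x : G) (hxN : x ∈ N) (hx : x ∉ (N : Set G) \ interior O) : x ∈ O := by
    by_contra hxO
    exact hx ⟨hxN, fun h ↦ hxO (interior_subset h)⟩
  refine ⟨‹_›, ‹_›, fun s hts hs hs2 ↦ ?_⟩
  have hNs := hNc.of_coarser hts
  -- The two topologies have the same traces of neighbourhoods of `1` on `N`.
  have trace : ∀ O ∈ @nhds G t 1, ∃ V ∈ @nhds G s 1, ∀ x ∈ V, x ∈ N → x ∈ O := fun O hO ↦
    -- The part of `N` outside `interior O` is compact, hence `s`-closed, and misses `1`.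
    ⟨_, (@IsCompact.isClosed G s hs2 _ ((hdiff O).of_coarser hts)).isOpen_compl.mem_nhds
      (hint O hO), fun x hx hxN ↦ hsub O x hxN hx⟩
  have hN : (N : Set G) ∈ @nhds G s 1 := by
    obtain ⟨V, hV, hVU⟩ := trace U hU
    let := s
    -- Tube lemma: commutators are trivial at `g = 1`, and `N` is `s`-compact.
    have h : ∀ᶠ g in 𝓝 (1 : G), ∀ x ∈ (N : Set G), g * x * g⁻¹ * x⁻¹ ∈ V := by
      refine hNs.eventually_forall_of_forall_eventually fun x _ ↦ ?_
      have hf : Continuous fun z : G × G ↦ z.1 * z.2 * z.1⁻¹ * z.2⁻¹ := by fun_prop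
      exact hf.continuousAt.preimage_mem_nhds (by simpa using hV)
    filter_upwards [h] with g hg
    exact hNU g fun x hx ↦ hVU _ (hg x hx)
      (N.mul_mem (‹N.Normal›.conj_mem x hx g) (N.inv_mem hx))
  refine IsTopologicalGroup.ext hs ‹_› (le_antisymm (fun O hO ↦ ?_) (nhds_mono hts))
  obtain ⟨V, hV, hVO⟩ := trace O hO
  filter_upwards [hV, hN] with x hxV hxN using hVO x hxV hxN

namespace RegularWreathProduct

variable {D Q : Type*}

/-- The unrestricted wreath product carries the topology of `(Q → D) × Q`. -/
instance [TopologicalSpace D] [TopologicalSpace Q] : TopologicalSpace (D ≀ᵣ Q) :=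
  .induced (equivProd D Q) inferInstance

section Topology

variable [TopologicalSpace D] [TopologicalSpace Q]

/-- The wreath product is homeomorphic to the product `(Q → D) × Q`. -/
def homeomorphProd : D ≀ᵣ Q ≃ₜ (Q → D) × Q :=
  (equivProd D Q).toHomeomorphOfIsInducing ⟨rfl⟩

theorem continuous_left : Continuous (left : D ≀ᵣ Q → Q → D) :=
  continuous_fst.comp homeomorphProd.continuous

theorem continuous_right : Continuous (right : D ≀ᵣ Q → Q) :=
  continuous_snd.comp homeomorphProd.continuous

theorem continuous_mk {Y : Type*} [TopologicalSpace Y] {f : Y → Q → D} {g : Y → Q}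
    (hf : Continuous f) (hg : Continuous g) :
    Continuous fun y ↦ (⟨f y, g y⟩ : D ≀ᵣ Q) :=
  homeomorphProd.symm.continuous.comp (hf.prodMk hg)

instance [T2Space D] [T2Space Q] : T2Space (D ≀ᵣ Q) :=
  homeomorphProd.symm.t2Space

theorem continuous_eval_of_discrete [DiscreteTopology Q] {Y : Type*} [TopologicalSpace Y]
    {f : Y → Q → D} {g : Y → Q} (hf : Continuous f) (hg : Continuous g) :
    Continuous fun y ↦ f y (g y) := by
  have h : Continuous fun p : (Q → D) × Q ↦ p.1 p.2 :=
    continuous_prod_of_discrete_right.2 fun q ↦ continuous_apply q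
  exact h.comp (hf.prodMk hg)

end Topology

variable [Group D] [Group Q] [TopologicalSpace D] [TopologicalSpace Q]
  [IsTopologicalGroup D] [DiscreteTopology Q]

instance : IsTopologicalGroup (D ≀ᵣ Q) where
  continuous_mul := by
    have h₁ := continuous_left (D := D) (Q := Q)
    have h₂ := continuous_right (D := D) (Q := Q)
    refine continuous_mk ((h₁.comp continuous_fst).mul (continuous_pi fun x ↦ ?_))
      ((h₂.comp continuous_fst).mul (h₂.comp continuous_snd))
    exact continuous_eval_of_discrete (h₁.comp continuous_snd)
      ((h₂.comp continuous_fst).inv.mul continuous_const)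
  continuous_inv := by
    have h₁ := continuous_left (D := D) (Q := Q)
    have h₂ := continuous_right (D := D) (Q := Q)
    exact continuous_mk (continuous_pi fun x ↦
      continuous_eval_of_discrete h₁.inv (h₂.mul continuous_const)) h₂.inv

/-- The unrestricted wreath product of a nontrivial compact Hausdorff group by a discrete group is
a minimal topological group. -/
theorem isMinimalTopologicalGroup [CompactSpace D] [T2Space D] [Nontrivial D] :
    IsMinimalTopologicalGroup (D ≀ᵣ Q) := by
  classical
  have hker : ((rightHom : D ≀ᵣ Q →* Q).ker : Set (D ≀ᵣ Q)) = right ⁻¹' {1} := by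
    ext; simp [MonoidHom.mem_ker]
  obtain ⟨d, hd⟩ := exists_ne (1 : D)
  refine .of_isCompact rightHom.ker ?_ (U := {a | a.left 1 ≠ d⁻¹}) ?_ ?_
  · have h : IsCompact ((Set.univ : Set (Q → D)) ×ˢ ({1} : Set Q)) :=
      isCompact_univ.prod isCompact_singleton
    convert homeomorphProd.isCompact_preimage.2 h using 1
    rw [hker]
    ext a
    simp [homeomorphProd, equivProd]
  · have h : Continuous fun a : D ≀ᵣ Q ↦ a.left 1 := (continuous_apply 1).comp continuous_left
    exact (isOpen_ne.preimage h).mem_nhds (by simpa using hd)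
  · intro g hg
    by_contra hg1
    replace hg1 : g.right ≠ 1 := by simpa [MonoidHom.mem_ker] using hg1
    -- Conjugation by `g` moves the support off `1`, so the commutator has value `d⁻¹` there.
    refine hg ⟨Pi.mulSingle 1 d, 1⟩ (by simp [MonoidHom.mem_ker]) ?_
    have : g.right⁻¹ ≠ 1 := inv_ne_one.2 hg1
    simp [Pi.mulSingle_eq_of_ne this]

end RegularWreathProduct

namespace Homeomorph

/-- The tautological action of the homeomorphism group. -/
instance applyMulAction (X : Type*) [TopologicalSpace X] : MulAction (X ≃ₜ X) X where
  smul h x := h x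
  one_smul _ := rfl
  mul_smul _ _ _ := rfl

end Homeomorph

theorem corollary6p3 {X : Type u} [TopologicalSpace X] [CompactSpace X] [T2Space X]
    (hX : IsHomogeneousSpace X) :
    ∃ (M : Type u) (_ : Group M) (_ : TopologicalSpace M) (_ : MulAction M X),
      IsMinimalTopologicalGroup M ∧ ContinuousSMul M X ∧ MulAction.IsPretransitive M X := by
  let : TopologicalSpace (X ≃ₜ X) := ⊥
  have : DiscreteTopology (X ≃ₜ X) := ⟨rfl⟩
  let : MulAction (ℤˣ ≀ᵣ (X ≃ₜ X)) X := MulAction.compHom X RegularWreathProduct.rightHom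
  have : Nontrivial ℤˣ := ⟨1, -1, by decide⟩
  refine ⟨ℤˣ ≀ᵣ (X ≃ₜ X), inferInstance, inferInstance, inferInstance,
    RegularWreathProduct.isMinimalTopologicalGroup, ⟨?_⟩, ⟨fun x y ↦ ?_⟩⟩
  · have h : Continuous fun p : (X ≃ₜ X) × X ↦ p.1 p.2 :=
      continuous_prod_of_discrete_left.2 fun f ↦ f.continuous
    exact h.comp ((RegularWreathProduct.continuous_right.comp continuous_fst).prodMk continuous_snd)
  · obtain ⟨f, hf⟩ := hX x y
    exact ⟨RegularWreathProduct.inl f, hf⟩
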